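/- Let $(X_i)_{i\ge 1}$ be independent random variables with values in $\mathbb Z_+=\{0,1,2,\dots\}$, and set $S_{a,n}:=\sum_{i=a+1}^n X_i$ for integers $0\le a<n$. For integers $i,d\ge 1$ let $$q(i,d):=\min\bigl\{\mathbb P[X_i=0]\,\mathbb P[X_{i+d}=i+d],\ \mathbb P[X_i=i]\,\mathbb P[X_{i+d}=0]\bigr\}.$$ Let $r,s\ge 1$ be coprime integers and let $D:=\{r\}\cup\{s2^g : g\ge 0\}$. Suppose that, for some integer $k\ge 1$ and some real $\psi>0$, for every $d\in D$ and every integer $j\ge 1$ the block $\{jk+1,\dots,(j+1)k\}$ contains an index $i$ with $q(i,d)\ge \psi/(i+d)$. Then there exist real numbers $C,\gamma>0$, depending only on $r,s,k$ and $\psi$, such that $$d_{TV}\bigl(\mathcal L(S_{a,n}),\mathcal L(S_{a,n}+1)\bigr)\ \le\ 6\left(\frac{a+1}{n}\right)^{\gamma}$$ for all integers $0\le a<n$ with $a+1\le Cn$. Here $\mathcal L(Y)$ denotes the law of $Y$ and $d_{TV}(\mu,\nu)=\sup_A|\mu(A)-\nu(A)|$, the supremum being over all sets $A$ of non-negative integers.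 -/

import Mathlib

open MeasureTheory ProbabilityTheory

noncomputable section

namespace DickmanCoupling

/-- Total variation distance `sup_A |μ(A) - ν(A)|`, over measurable sets `A`, between two
probability measures. -/
def tvDist {α : Type*} [MeasurableSpace α] (μ ν : Measure α) : ℝ :=
  ⨆ A : {A : Set α // MeasurableSet A}, |μ.real A.1 - ν.real A.1|

variable {Ω : Type*} [MeasurableSpace Ω]

/-- The partial sum `S_{a,n} = X_{a+1} + ⋯ + X_n`. -/
def partialSum (X : ℕ → Ω → ℕ) (a n : ℕ) (ω : Ω) : ℕ :=
  ∑ i ∈ Finset.Ioc a n, X i ω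

/-- `q(i,d) = min {P[X_i = 0] P[X_{i+d} = i+d], P[X_i = i] P[X_{i+d} = 0]}`. -/
def q (P : Measure Ω) (X : ℕ → Ω → ℕ) (i d : ℕ) : ℝ :=
  min (P.real {ω | X i ω = 0} * P.real {ω | X (i + d) ω = i + d})
    (P.real {ω | X i ω = i} * P.real {ω | X (i + d) ω = 0})

/-- `E(d,ψ)`, the set of the indices `i ≥ 1` with `q(i,d) ≥ ψ / (i+d)`. -/
def goodIndices (P : Measure Ω) (X : ℕ → Ω → ℕ) (d : ℕ) (ψ : ℝ) : Set ℕ :=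
  {i | 1 ≤ i ∧ ψ / ((i : ℝ) + (d : ℝ)) ≤ q P X i d}

/-- For every `d ∈ D` and `j ≥ 1`, the set `E(d,ψ)` meets the block `{jk+1, …, (j+1)k}`. -/
def BlockCondition (P : Measure Ω) (X : ℕ → Ω → ℕ) (D : Set ℕ) (k : ℕ) (ψ : ℝ) : Prop :=
  ∀ d ∈ D, ∀ j : ℕ, 1 ≤ j →
    (goodIndices P X d ψ ∩ Set.Icc (j * k + 1) ((j + 1) * k)).Nonempty

/-- The set `D = {r} ∪ {s 2^g : g ≥ 0}` of step sizes. -/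
def stepSizes (r s : ℕ) : Set ℕ :=
  {r} ∪ Set.range (fun g : ℕ => s * 2 ^ g)

end DickmanCoupling

end

/-! Write `b(t)` for the total variation distance between the law of a partial sum and its translate
by `t`. The event `X i = i, X (i+d) = 0` and the event `X i = 0, X (i+d) = i+d` give the pair the
sums `i` and `i+d`, so two copies of the sum can be coupled with these values exchanged. Such an
exchange replaces the shift `t` by `t + d` or `t - d` with equal weights (`ShiftBound.conv_swap`).
Since `q(i,d)` is at least of order `1/i` once per block, the range `(kv, 4kv]` contains enough
disjoint pairs to exchange with probability at least `1 - exp(-ψ/(2k))`, whatever `v` is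
(`ShiftBound.sumLaw_Ioc_step`). Each factor 4 in the range of summation is thus one step of
averaging.

Two games are played, each over `L` scales. With `d = t = s 2^g` the shift either vanishes or
doubles, so `b(s)` decays like `ρ^L` (`shiftBound_doubling`). With `d = r`, the shift `1` walks
along `1 + r m` until it reaches one of two multiples of `s`, which exist by coprimality; failing to
do so within `L` scales costs another `O(ρ^L)` (`shiftBound_walk`). The upper scales serve the
doubling and the lower ones the walk, so `16^L` is of order `n/(a+1)` and `ρ^L` is a power of
`(a+1)/n`. -/

namespace DickmanCoupling

/-! ### Calculus of shift bounds on the integers. -/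

section ShiftBound

/-- `c` bounds the total variation distance between `ν` and its translate by `t`. -/
def ShiftBound (ν : Measure ℤ) (t : ℤ) (c : ℝ) : Prop :=
  ∀ φ : ℤ → ℝ, (∀ x, 0 ≤ φ x ∧ φ x ≤ 1) → ∫ x, (φ x - φ (x + t)) ∂ν ≤ c

lemma integrable_of_abs_le {ν : Measure ℤ} [IsFiniteMeasure ν] {f : ℤ → ℝ} (C : ℝ)
    (hf : ∀ x, |f x| ≤ C) : Integrable f ν :=
  Integrable.of_bound (measurable_of_countable f).aestronglyMeasurable C
    (Filter.Eventually.of_forall hf)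

lemma abs_le_one_of_mem {φ : ℤ → ℝ} (hφ : ∀ x, 0 ≤ φ x ∧ φ x ≤ 1) (x : ℤ) : |φ x| ≤ 1 :=
  abs_le.2 ⟨by linarith [(hφ x).1], (hφ x).2⟩

lemma abs_sub_le_one {φ : ℤ → ℝ} (hφ : ∀ x, 0 ≤ φ x ∧ φ x ≤ 1) (x y : ℤ) :
    |φ x - φ y| ≤ 1 :=
  abs_le.2 ⟨by linarith [(hφ x).1, (hφ y).2], by linarith [(hφ x).2, (hφ y).1]⟩

variable {μ ν : Measure ℤ} {t t' : ℤ} {c c' : ℝ}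

lemma ShiftBound.mono (h : ShiftBound ν t c) (hc : c ≤ c') : ShiftBound ν t c' :=
  fun φ hφ => (h φ hφ).trans hc

lemma shiftBound_zero (ν : Measure ℤ) : ShiftBound ν 0 0 := fun φ _ => by simp

lemma shiftBound_one (ν : Measure ℤ) [IsProbabilityMeasure ν] (t : ℤ) : ShiftBound ν t 1 := by
  intro φ hφ
  calc ∫ x, (φ x - φ (x + t)) ∂ν ≤ ∫ _, (1 : ℝ) ∂ν :=
        integral_mono (integrable_of_abs_le 1 fun x => abs_sub_le_one hφ _ _)
          (integrable_const _) fun x => (abs_le.1 (abs_sub_le_one hφ _ _)).2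
    _ = 1 := by simp

lemma ShiftBound.neg (h : ShiftBound ν t c) : ShiftBound ν (-t) c := by
  intro φ hφ
  have := h (fun x => 1 - φ (x - t)) fun x =>
    ⟨by linarith [(hφ (x - t)).2], by linarith [(hφ (x - t)).1]⟩
  refine le_of_eq_of_le (integral_congr_ae (Filter.Eventually.of_forall fun x => ?_)) this
  simp only [add_sub_cancel_right, ← sub_eq_add_neg]
  ring

lemma ShiftBound.add [IsFiniteMeasure ν] (h : ShiftBound ν t c) (h' : ShiftBound ν t' c') :
    ShiftBound ν (t + t') (c + c') := by
  intro φ hφ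
  have h1 := h φ hφ
  have h2 := h' (fun x => φ (x + t)) fun x => hφ _
  calc ∫ x, (φ x - φ (x + (t + t'))) ∂ν
      = ∫ x, ((φ x - φ (x + t)) + (φ (x + t) - φ (x + t' + t))) ∂ν := by
        congr 1; ext x
        rw [show x + (t + t') = x + t' + t by ring]; ring
    _ = ∫ x, (φ x - φ (x + t)) ∂ν + ∫ x, (φ (x + t) - φ (x + t' + t)) ∂ν :=
        integral_add (integrable_of_abs_le 1 fun x => abs_sub_le_one hφ _ _)
          (integrable_of_abs_le 1 fun x => abs_sub_le_one hφ _ _)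
    _ ≤ c + c' := add_le_add h1 h2

lemma ShiftBound.nat_mul [IsFiniteMeasure ν] (h : ShiftBound ν t c) (m : ℕ) :
    ShiftBound ν (t * m) (c * m) := by
  induction m with
  | zero => simpa using shiftBound_zero ν
  | succ m ih =>
    convert ih.add h using 1 <;> push_cast <;> ring

lemma ShiftBound.int_mul [IsFiniteMeasure ν] (h : ShiftBound ν t c) (m : ℤ) :
    ShiftBound ν (t * m) (c * m.natAbs) := by
  rcases Int.natAbs_eq m with hm | hm
  · have := h.nat_mul m.natAbs
    rwa [← hm] at this
  · have := (h.nat_mul m.natAbs).neg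
    rwa [← mul_neg, ← hm] at this

lemma integral_conv_of_abs_le [IsFiniteMeasure μ] [IsFiniteMeasure ν] {f : ℤ → ℝ} (C : ℝ)
    (hf : ∀ x, |f x| ≤ C) : ∫ x, f x ∂(μ ∗ ν) = ∫ x, ∫ y, f (x + y) ∂ν ∂μ := by
  rw [Measure.conv, integral_map (by fun_prop) (measurable_of_countable f).aestronglyMeasurable,
    integral_prod]
  exact Integrable.of_bound (measurable_of_countable _).aestronglyMeasurable C
    (Filter.Eventually.of_forall fun x => hf _)

lemma ShiftBound.conv_left [IsProbabilityMeasure μ] [IsFiniteMeasure ν]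
    (h : ShiftBound ν t c) : ShiftBound (μ ∗ ν) t c := by
  intro φ hφ
  rw [integral_conv_of_abs_le 1 fun x => abs_sub_le_one hφ _ _]
  have key : ∀ x, ∫ y, (φ (x + y) - φ (x + y + t)) ∂ν ≤ c := fun x => by
    simpa only [add_assoc] using h (fun y => φ (x + y)) fun y => hφ _
  calc _ ≤ ∫ _, c ∂μ := by
        refine integral_mono (integrable_of_abs_le (ν.real Set.univ) fun x => ?_)
          (integrable_const _) key
        simpa using norm_integral_le_of_norm_le_const (μ := ν) (C := 1)
          (f := fun y => φ (x + y) - φ (x + y + t))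
          (Filter.Eventually.of_forall fun y => abs_sub_le_one hφ (x + y) (x + y + t))
    _ = c := by simp

/-- Exchanging two atoms of `μ` at distance `d` turns a shift by `t` into a shift by `t ± d`. -/
lemma ShiftBound.conv_swap [IsProbabilityMeasure μ] [IsProbabilityMeasure ν] {u d : ℤ}
    {q c₀ c₁ c₂ : ℝ} (hd : d ≠ 0) (hq : 0 ≤ q) (hu : q ≤ μ.real {u}) (hud : q ≤ μ.real {u + d})
    (h₀ : ShiftBound ν t c₀) (h₁ : ShiftBound ν (t + d) c₁) (h₂ : ShiftBound ν (t - d) c₂) :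
    ShiftBound (μ ∗ ν) t ((1 - 2 * q) * c₀ + q * (c₁ + c₂)) := by
  intro φ hφ
  rw [integral_conv_of_abs_le 1 fun x => abs_sub_le_one hφ _ _]
  set Φ : ℤ → ℝ := fun x => ∫ y, φ (x + y) ∂ν with hΦ
  have hint : ∀ x, Integrable (fun y => φ (x + y)) ν := fun x =>
    integrable_of_abs_le 1 fun y => abs_le_one_of_mem hφ _
  have hdiff : ∀ x z c, ShiftBound ν z c → Φ x - Φ (x + z) ≤ c := fun x z c h => by
    have := h (fun y => φ (x + y)) fun y => hφ _
    rw [integral_sub (hint x) (integrable_of_abs_le 1 fun y => abs_le_one_of_mem hφ _)] at this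
    simpa only [hΦ, add_assoc, add_comm z] using this
  have hin : ∀ x, ∫ y, (φ (x + y) - φ (x + y + t)) ∂ν = Φ x - Φ (x + t) := fun x => by
    rw [integral_sub (hint x) (integrable_of_abs_le 1 fun y => abs_le_one_of_mem hφ _)]
    simp only [hΦ, add_assoc, add_comm t]
  simp_rw [hin]
  set g : ℤ → ℝ := fun x => Φ x - Φ (x + t) with hg
  have hg0 : ∀ x, g x ≤ c₀ := fun x => hdiff x t c₀ h₀
  have hΦ1 : ∀ x, 0 ≤ Φ x ∧ Φ x ≤ 1 := fun x => by
    refine ⟨integral_nonneg fun y => (hφ _).1, ?_⟩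
    calc Φ x ≤ ∫ _, (1 : ℝ) ∂ν :=
          integral_mono (hint x) (integrable_const _) fun y => (hφ _).2
      _ = 1 := by simp
  have hgi : Integrable g μ := integrable_of_abs_le 1 fun x => abs_sub_le_one hΦ1 _ _
  have hfi : Integrable (fun x => c₀ - g x) μ := (integrable_const _).sub hgi
  have hne : u ≠ u + d := by omega
  have hset : ∫ x in ({u, u + d} : Set ℤ), (c₀ - g x) ∂μ ≤ ∫ x, (c₀ - g x) ∂μ :=
    setIntegral_le_integral hfi (Filter.Eventually.of_forall fun x => sub_nonneg.2 (hg0 x))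
  rw [show ({u, u + d} : Set ℤ) = {u} ∪ {u + d} from rfl,
    setIntegral_union (by simpa using hne) (measurableSet_singleton _) hfi.integrableOn
      hfi.integrableOn, integral_singleton, integral_singleton, integral_sub (integrable_const _) hgi]
    at hset
  simp only [smul_eq_mul, integral_const, probReal_univ, one_mul] at hset
  -- Cross-pairing: `u` is compared with `u + d + t`, and `u + d` with `u + t`.
  have hsum : g u + g (u + d) ≤ c₁ + c₂ := by
    have e1 := hdiff u (t + d) c₁ h₁
    have e2 := hdiff (u + d) (t - d) c₂ h₂
    rw [show u + (t + d) = u + d + t by ring] at e1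
    rw [show u + d + (t - d) = u + t by ring] at e2
    simp only [hg]; linarith
  have f1 := mul_le_mul_of_nonneg_right hu (sub_nonneg.2 (hg0 u))
  have f2 := mul_le_mul_of_nonneg_right hud (sub_nonneg.2 (hg0 (u + d)))
  have := mul_le_mul_of_nonneg_left hsum hq
  linarith

end ShiftBound

/-! ### Laws of partial sums and exchanges along disjoint pairs. -/

section SumLaw

variable {Ω : Type*} [MeasurableSpace Ω]

lemma q_nonneg (P : Measure Ω) (X : ℕ → Ω → ℕ) (i d : ℕ) : 0 ≤ q P X i d :=
  le_min (by positivity) (by positivity)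

/-- The law of `∑ i ∈ J, X i`, as a measure on the integers. -/
noncomputable def sumLaw (P : Measure Ω) (X : ℕ → Ω → ℕ) (J : Finset ℕ) : Measure ℤ :=
  P.map fun ω => ((∑ i ∈ J, X i ω : ℕ) : ℤ)

variable {P : Measure Ω} {X : ℕ → Ω → ℕ}

lemma measurable_finsetSum (hX : ∀ i, 1 ≤ i → Measurable (X i)) {J : Finset ℕ}
    (hJ : ∀ i ∈ J, 1 ≤ i) : Measurable fun ω => ∑ i ∈ J, X i ω :=
  Finset.measurable_fun_sum J fun i hi => hX i (hJ i hi)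

lemma isProbabilityMeasure_sumLaw [IsProbabilityMeasure P] (hX : ∀ i, 1 ≤ i → Measurable (X i)) {J : Finset ℕ}
    (hJ : ∀ i ∈ J, 1 ≤ i) : IsProbabilityMeasure (sumLaw P X J) :=
  Measure.isProbabilityMeasure_map
    ((measurable_of_countable _).comp (measurable_finsetSum hX hJ)).aemeasurable

lemma indepFun_finsetSum (hX : ∀ i, 1 ≤ i → Measurable (X i))
    (hind : iIndepFun (fun i : ℕ+ => X (i : ℕ)) P) {J K : Finset ℕ} (hJ : ∀ i ∈ J, 1 ≤ i)
    (hK : ∀ i ∈ K, 1 ≤ i) (hJK : Disjoint J K) :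
    IndepFun (fun ω => ∑ i ∈ J, X i ω) (fun ω => ∑ i ∈ K, X i ω) P := by
  have key : ∀ J : Finset ℕ, (∀ i ∈ J, 1 ≤ i) → ∃ S : Finset ℕ+, (∀ i ∈ S, (i : ℕ) ∈ J) ∧
      ∀ ω, ∑ i ∈ J, X i ω = ∑ i ∈ S, X (i : ℕ) ω := by
    intro J hJ
    refine ⟨J.preimage (fun i : ℕ+ => (i : ℕ)) PNat.coe_injective.injOn,
      fun i hi => Finset.mem_preimage.1 hi, fun ω => ?_⟩
    exact (Finset.sum_preimage (fun i : ℕ+ => (i : ℕ)) J PNat.coe_injective.injOn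
      (fun i => X i ω) fun i hi h => (h ⟨⟨i, hJ i hi⟩, rfl⟩).elim).symm
  obtain ⟨S, hS, hSX⟩ := key J hJ
  obtain ⟨T, hT, hTX⟩ := key K hK
  have h := hind.indepFun_finset S T
    (Finset.disjoint_left.2 fun i hi hi' => Finset.disjoint_left.1 hJK (hS i hi) (hT i hi'))
    fun i => hX i i.2
  have h' := h.comp (φ := fun v => ∑ i, v i) (ψ := fun v => ∑ i, v i)
    (Finset.measurable_fun_sum _ fun i _ => measurable_pi_apply i)
    (Finset.measurable_fun_sum _ fun i _ => measurable_pi_apply i)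
  convert h' using 1
  · ext ω
    rw [hSX ω]
    exact (Finset.sum_coe_sort S fun i => X (i : ℕ) ω).symm
  · ext ω
    rw [hTX ω]
    exact (Finset.sum_coe_sort T fun i => X (i : ℕ) ω).symm

variable [IsProbabilityMeasure P]

lemma sumLaw_union (hX : ∀ i, 1 ≤ i → Measurable (X i))
    (hind : iIndepFun (fun i : ℕ+ => X (i : ℕ)) P) {J K : Finset ℕ} (hJ : ∀ i ∈ J, 1 ≤ i)
    (hK : ∀ i ∈ K, 1 ≤ i) (hJK : Disjoint J K) :
    sumLaw P X (J ∪ K) = sumLaw P X J ∗ sumLaw P X K := by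
  have h := (indepFun_finsetSum hX hind hJ hK hJK).comp (φ := fun m : ℕ => (m : ℤ))
    (ψ := fun m : ℕ => (m : ℤ)) (measurable_of_countable _) (measurable_of_countable _)
  have := h.map_add_eq_map_conv_map
    ((measurable_of_countable _).comp (measurable_finsetSum hX hJ))
    ((measurable_of_countable _).comp (measurable_finsetSum hX hK))
  rw [sumLaw, sumLaw, sumLaw]
  refine Eq.trans ?_ this
  congr 1
  ext ω
  simp [Finset.sum_union hJK]

lemma ShiftBound.sumLaw_mono (hX : ∀ i, 1 ≤ i → Measurable (X i))
    (hind : iIndepFun (fun i : ℕ+ => X (i : ℕ)) P) {J K : Finset ℕ} {t : ℤ} {c : ℝ}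
    (h : ShiftBound (sumLaw P X J) t c) (hJK : J ⊆ K) (hK : ∀ i ∈ K, 1 ≤ i) :
    ShiftBound (sumLaw P X K) t c := by
  have h1 : ∀ i ∈ K \ J, 1 ≤ i := fun i hi => hK i (Finset.mem_sdiff.1 hi).1
  have h2 : ∀ i ∈ J, 1 ≤ i := fun i hi => hK i (hJK hi)
  have := isProbabilityMeasure_sumLaw (P := P) hX h1
  have := isProbabilityMeasure_sumLaw (P := P) hX h2
  rw [← Finset.sdiff_union_of_subset hJK, sumLaw_union hX hind h1 h2 Finset.sdiff_disjoint]
  exact h.conv_left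

lemma prob_mul_le_sumLaw_pair (hX : ∀ i, 1 ≤ i → Measurable (X i))
    (hind : iIndepFun (fun i : ℕ+ => X (i : ℕ)) P) {i j : ℕ} (hi : 1 ≤ i) (hj : 1 ≤ j)
    (hij : i ≠ j) (x y : ℕ) :
    P.real {ω | X i ω = x} * P.real {ω | X j ω = y}
      ≤ (sumLaw P X {i, j}).real {((x + y : ℕ) : ℤ)} := by
  have hI : IndepFun (X i) (X j) P := by
    have := indepFun_finsetSum hX hind (J := {i}) (K := {j}) (by simpa) (by simpa) (by simpa)
    simpa using this
  have hpair : ∀ l ∈ ({i, j} : Finset ℕ), 1 ≤ l := by simp [hi, hj]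
  have hm : Measurable fun ω => ((∑ l ∈ ({i, j} : Finset ℕ), X l ω : ℕ) : ℤ) :=
    (measurable_of_countable _).comp (measurable_finsetSum hX hpair)
  have h1 := hI.measure_inter_preimage_eq_mul {x} {y} (measurableSet_singleton _)
    (measurableSet_singleton _)
  have h2 : P.real {ω | X i ω = x} * P.real {ω | X j ω = y}
      = P.real (X i ⁻¹' {x} ∩ X j ⁻¹' {y}) := by
    rw [measureReal_def, measureReal_def, measureReal_def, h1, ENNReal.toReal_mul]; rfl
  rw [h2, sumLaw, map_measureReal_apply hm (measurableSet_singleton _)]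
  refine measureReal_mono fun ω hω => ?_
  simp only [Set.mem_inter_iff, Set.mem_preimage, Set.mem_singleton_iff] at hω ⊢
  rw [Finset.sum_pair hij, hω.1, hω.2]

lemma q_le_sumLaw_pair (hX : ∀ i, 1 ≤ i → Measurable (X i))
    (hind : iIndepFun (fun i : ℕ+ => X (i : ℕ)) P) {i d : ℕ} (hi : 1 ≤ i) (hd : 1 ≤ d) :
    q P X i d ≤ (sumLaw P X {i, i + d}).real {(i : ℤ)} ∧
      q P X i d ≤ (sumLaw P X {i, i + d}).real {(i : ℤ) + d} := by
  have h := prob_mul_le_sumLaw_pair hX hind hi (show 1 ≤ i + d by omega)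
    (show i ≠ i + d by omega)
  refine ⟨(min_le_right _ _).trans ?_, (min_le_left _ _).trans ?_⟩
  · simpa using h i 0
  · simpa using h 0 (i + d)

lemma two_mul_q_le_one (hX : ∀ i, 1 ≤ i → Measurable (X i))
    (hind : iIndepFun (fun i : ℕ+ => X (i : ℕ)) P) {i d : ℕ} (hi : 1 ≤ i) (hd : 1 ≤ d) :
    2 * q P X i d ≤ 1 := by
  obtain ⟨h1, h2⟩ := q_le_sumLaw_pair hX hind hi hd
  have := isProbabilityMeasure_sumLaw (P := P) (J := {i, i + d}) hX (by simp; omega)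
  have h3 := measureReal_union (μ := sumLaw P X {i, i + d}) (s₁ := {(i : ℤ)})
    (s₂ := {(i : ℤ) + d}) (by simp; omega) (measurableSet_singleton _)
  have h4 : (sumLaw P X {i, i + d}).real ({(i : ℤ)} ∪ {(i : ℤ) + d}) ≤ 1 := measureReal_le_one
  linarith

/-- Iterates `ShiftBound.conv_swap` over the disjoint pairs `{i, i+d}`, `i ∈ B`. The product is the
weight of no exchange at all; the first exchange to succeed settles the shift at `t ± d`. -/
lemma ShiftBound.sumLaw_swaps (hX : ∀ i, 1 ≤ i → Measurable (X i))
    (hind : iIndepFun (fun i : ℕ+ => X (i : ℕ)) P) {d : ℕ} (hd : 1 ≤ d) {J : Finset ℕ}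
    (hJ : ∀ i ∈ J, 1 ≤ i) {t : ℤ} {c₀ c₁ c₂ : ℝ}
    (h₀ : ShiftBound (sumLaw P X J) t c₀) (h₁ : ShiftBound (sumLaw P X J) (t + d) c₁)
    (h₂ : ShiftBound (sumLaw P X J) (t - d) c₂) (B : Finset ℕ) (hB : ∀ i ∈ B, 1 ≤ i)
    (hBJ : ∀ i ∈ B, i ∉ J) (hBd : ∀ i ∈ B, i + d ∉ B) (hBdJ : ∀ i ∈ B, i + d ∉ J) :
    ShiftBound (sumLaw P X (B ∪ B.image (· + d) ∪ J)) t
      ((∏ i ∈ B, (1 - 2 * q P X i d)) * c₀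
        + (1 - ∏ i ∈ B, (1 - 2 * q P X i d)) * ((c₁ + c₂) / 2)) := by
  induction B using Finset.induction_on with
  | empty => simpa using h₀
  | insert i B hi ih =>
    simp only [Finset.mem_insert, forall_eq_or_imp, not_or] at hB hBJ hBd hBdJ
    have ih := ih hB.2 hBJ.2 (fun b hb => (hBd.2 b hb).2) hBdJ.2
    set R := B ∪ B.image (· + d) ∪ J with hR
    have hR1 : ∀ l ∈ R, 1 ≤ l := by
      intro l hl
      simp only [hR, Finset.mem_union, Finset.mem_image] at hl
      rcases hl with (hl | ⟨b, hb, rfl⟩) | hl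
      · exact hB.2 l hl
      · omega
      · exact hJ l hl
    have hpair : ∀ l ∈ ({i, i + d} : Finset ℕ), 1 ≤ l := by simp; omega
    have hset : insert i B ∪ (insert i B).image (· + d) ∪ J = {i, i + d} ∪ R := by
      ext l; simp only [hR, Finset.image_insert, Finset.mem_union, Finset.mem_insert,
        Finset.mem_singleton]; tauto
    have hdis : Disjoint ({i, i + d} : Finset ℕ) R := by
      simp only [hR, Finset.disjoint_insert_left, Finset.disjoint_singleton_left,
        Finset.mem_union, Finset.mem_image, not_or, not_exists, not_and]
      refine ⟨⟨⟨hi, fun b hb => (hBd.2 b hb).1⟩, hBJ.1⟩, ⟨hBd.1.2, fun b hb hbi => ?_⟩, hBdJ.1⟩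
      exact hi (by rwa [← Nat.add_right_cancel hbi])
    have := isProbabilityMeasure_sumLaw (P := P) hX hpair
    have := isProbabilityMeasure_sumLaw (P := P) hX hR1
    have hJR : J ⊆ R := Finset.subset_union_right
    obtain ⟨q1, q2⟩ := q_le_sumLaw_pair hX hind hB.1 hd
    rw [hset, sumLaw_union hX hind hpair hR1 hdis, Finset.prod_insert hi]
    refine (ih.conv_swap (by omega : (d : ℤ) ≠ 0) (q_nonneg P X i d) q1 q2
      (h₁.sumLaw_mono hX hind hJR hR1) (h₂.sumLaw_mono hX hind hJR hR1)).mono (le_of_eq ?_)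
    ring

end SumLaw

/-! ### One scale: passing from `(4kv, n]` to `(kv, n]`. -/

section Phase

variable {Ω : Type*} [MeasurableSpace Ω]

lemma exists_separated_goodIndices {P : Measure Ω} {X : ℕ → Ω → ℕ} {d k v : ℕ} {ψ : ℝ}
    (hk : 1 ≤ k) (hv : 1 ≤ v) (hd : 1 ≤ d) (hdv : d ≤ k * v) (hψ : 0 < ψ)
    (hgood : ∀ j : ℕ, 1 ≤ j →
      (goodIndices P X d ψ ∩ Set.Icc (j * k + 1) ((j + 1) * k)).Nonempty) :
    ∃ B : Finset ℕ, (∀ i ∈ B, k * v < i ∧ i ≤ 3 * (k * v)) ∧ (∀ i ∈ B, i + d ∉ B) ∧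
      ψ / (4 * k) ≤ ∑ i ∈ B, q P X i d := by
  choose! f hf using hgood
  have hlow : ∀ j ∈ Finset.Ico v (3 * v), j * k + 1 ≤ f j ∧ f j ≤ (j + 1) * k := fun j hj =>
    (hf j (hv.trans (Finset.mem_Ico.1 hj).1)).2
  have hinj : Set.InjOn f (Finset.Ico v (3 * v) : Finset ℕ) := by
    refine StrictMonoOn.injOn fun j hj l hl hjl => ?_
    have := Nat.mul_le_mul_right k (Nat.succ_le_of_lt hjl)
    have h1 := hlow j hj
    have h2 := hlow l hl
    simp only [Nat.succ_eq_add_one] at this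
    omega
  have hrange : ∀ j ∈ Finset.Ico v (3 * v), k * v < f j ∧ f j ≤ 3 * (k * v) := by
    intro j hj
    have h1 := hlow j hj
    rw [Finset.mem_Ico] at hj
    have h2 := Nat.mul_le_mul_right k hj.1
    have h3 := Nat.mul_le_mul_right k (Nat.succ_le_of_lt hj.2)
    simp only [Nat.succ_eq_add_one] at h3
    constructor <;> nlinarith
  have hkR : (0 : ℝ) < k := by exact_mod_cast hk
  have hvR : (0 : ℝ) < v := by exact_mod_cast hv
  have hq : ∀ j ∈ Finset.Ico v (3 * v), ψ / (4 * (k * v)) ≤ q P X (f j) d := by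
    intro j hj
    have h1 := (hf j (hv.trans (Finset.mem_Ico.1 hj).1)).1.2
    have h2 := (hrange j hj).2
    have h3 : (0 : ℝ) < f j + d := by exact_mod_cast (by omega : 0 < f j + d)
    have h4 : (f j + d : ℝ) ≤ 4 * (k * v) := by exact_mod_cast (by omega : f j + d ≤ 4 * (k * v))
    exact (div_le_div_of_nonneg_left hψ.le h3 h4).trans h1
  -- There are `2v` blocks, and each contributes at least `ψ/(4kv)` because `f j + d ≤ 4kv`.
  have htot : ψ / (2 * k) ≤ ∑ j ∈ Finset.Ico v (3 * v), q P X (f j) d := by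
    calc ψ / (2 * k) = (Finset.Ico v (3 * v)).card • (ψ / (4 * (k * v))) := by
          rw [Nat.card_Ico, nsmul_eq_mul, show 3 * v - v = 2 * v by omega]
          push_cast
          field_simp
          ring
      _ ≤ _ := Finset.card_nsmul_le_sum _ _ _ hq
  have hmain : ∀ S ⊆ Finset.Ico v (3 * v), (∀ j ∈ S, ∀ l ∈ S, f j + d ≠ f l) →
      ψ / (4 * k) ≤ ∑ j ∈ S, q P X (f j) d → ∃ B : Finset ℕ,
      (∀ i ∈ B, k * v < i ∧ i ≤ 3 * (k * v)) ∧ (∀ i ∈ B, i + d ∉ B) ∧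
      ψ / (4 * k) ≤ ∑ i ∈ B, q P X i d := by
    intro S hS hsep hsum
    refine ⟨S.image f, ?_, ?_, ?_⟩
    · simp only [Finset.forall_mem_image]
      exact fun j hj => hrange j (hS hj)
    · rw [Finset.forall_mem_image]
      simp only [Finset.mem_image, not_exists, not_and]
      exact fun j hj l hl h => hsep j hj l hl h.symm
    · rwa [Finset.sum_image (hinj.mono (by exact_mod_cast hS))]
  -- Adding `d` flips the parity of `⌊i/d⌋`, so neither parity class contains two indices at
  -- distance `d`; the heavier class keeps half of the sum.
  have hpar : ∀ j l, f j + d = f l → f l / d = f j / d + 1 := fun j l h => by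
    rw [← h, Nat.add_div_right _ hd]
  rw [← Finset.sum_filter_add_sum_filter_not _ (fun j => Even (f j / d))] at htot
  have hhalf : ψ / (2 * k) = ψ / (4 * k) + ψ / (4 * k) := by field_simp; ring
  rcases le_total (ψ / (4 * k)) (∑ j ∈ Finset.Ico v (3 * v) with Even (f j / d), q P X (f j) d)
    with h | h
  · refine hmain _ (Finset.filter_subset _ _) (fun j hj l hl hjl => ?_) h
    have h1 := (Finset.mem_filter.1 hj).2
    have h2 := (Finset.mem_filter.1 hl).2
    rw [hpar j l hjl, Nat.even_add_one] at h2
    exact h2 h1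
  · refine hmain _ (Finset.filter_subset _ _) (fun j hj l hl hjl => ?_)
      (show _ ≤ ∑ j ∈ Finset.Ico v (3 * v) with ¬ Even (f j / d), q P X (f j) d by linarith)
    have h1 := (Finset.mem_filter.1 hj).2
    have h2 := (Finset.mem_filter.1 hl).2
    rw [hpar j l hjl, Nat.even_add_one] at h2
    exact h2 h1

variable {P : Measure Ω} [IsProbabilityMeasure P] {X : ℕ → Ω → ℕ}

lemma ShiftBound.sumLaw_Ioc_step (hX : ∀ i, 1 ≤ i → Measurable (X i))
    (hind : iIndepFun (fun i : ℕ+ => X (i : ℕ)) P) {d k v n : ℕ} {ψ : ℝ}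
    (hk : 1 ≤ k) (hv : 1 ≤ v) (hd : 1 ≤ d) (hdv : d ≤ k * v) (hψ : 0 < ψ)
    (hgood : ∀ j : ℕ, 1 ≤ j →
      (goodIndices P X d ψ ∩ Set.Icc (j * k + 1) ((j + 1) * k)).Nonempty)
    (hn : 4 * (k * v) ≤ n) {t : ℤ} {c₀ c₁ c₂ : ℝ}
    (h₀ : ShiftBound (sumLaw P X (Finset.Ioc (4 * (k * v)) n)) t c₀)
    (h₁ : ShiftBound (sumLaw P X (Finset.Ioc (4 * (k * v)) n)) (t + d) c₁)
    (h₂ : ShiftBound (sumLaw P X (Finset.Ioc (4 * (k * v)) n)) (t - d) c₂)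
    (hc : (c₁ + c₂) / 2 ≤ c₀) :
    ShiftBound (sumLaw P X (Finset.Ioc (k * v) n)) t
      (Real.exp (-(ψ / (2 * k))) * c₀
        + (1 - Real.exp (-(ψ / (2 * k)))) * ((c₁ + c₂) / 2)) := by
  obtain ⟨B, hB, hBd, hsum⟩ := exists_separated_goodIndices hk hv hd hdv hψ hgood
  have hB1 : ∀ i ∈ B, 1 ≤ i := fun i hi => by have := hB i hi; omega
  have h := ShiftBound.sumLaw_swaps hX hind hd (J := Finset.Ioc (4 * (k * v)) n)
    (fun i hi => by rw [Finset.mem_Ioc] at hi; omega) h₀ h₁ h₂ B hB1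
    (fun i hi => by have := hB i hi; rw [Finset.mem_Ioc]; omega) hBd
    (fun i hi => by have := hB i hi; rw [Finset.mem_Ioc]; omega)
  have h := h.sumLaw_mono hX hind (K := Finset.Ioc (k * v) n) (by
      intro l hl
      simp only [Finset.mem_union, Finset.mem_image, Finset.mem_Ioc] at hl ⊢
      rcases hl with (hl | ⟨b, hb, rfl⟩) | hl
      · have := hB l hl; omega
      · have := hB b hb; omega
      · omega) (fun i hi => by rw [Finset.mem_Ioc] at hi; omega)
  refine h.mono ?_
  have hprod : ∏ i ∈ B, (1 - 2 * q P X i d) ≤ Real.exp (-(ψ / (2 * k))) := by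
    calc ∏ i ∈ B, (1 - 2 * q P X i d) ≤ ∏ i ∈ B, Real.exp (-(2 * q P X i d)) :=
          Finset.prod_le_prod
            (fun i hi => by linarith [two_mul_q_le_one hX hind (hB1 i hi) hd])
            fun i _ => Real.one_sub_le_exp_neg _
      _ = Real.exp (-(2 * ∑ i ∈ B, q P X i d)) := by
          rw [← Real.exp_sum, Finset.sum_neg_distrib, Finset.mul_sum]
      _ ≤ _ := by
          refine Real.exp_le_exp.2 (neg_le_neg ?_)
          calc ψ / (2 * k) = 2 * (ψ / (4 * k)) := by field_simp; ring
            _ ≤ _ := by linarith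
  -- As `(c₁ + c₂)/2 ≤ c₀`, lowering the weight of `c₀` lowers the bound, so replacing the product
  -- by the larger exponential is safe.
  nlinarith [mul_nonneg (sub_nonneg.2 hprod) (sub_nonneg.2 hc)]

end Phase

/-! ### Geometric decay over many scales. -/

section Decay

variable {Ω : Type*} [MeasurableSpace Ω] {P : Measure Ω} [IsProbabilityMeasure P]
  {X : ℕ → Ω → ℕ}

lemma isProbabilityMeasure_sumLaw_Ioc (hX : ∀ i, 1 ≤ i → Measurable (X i)) (a n : ℕ) :
    IsProbabilityMeasure (sumLaw P X (Finset.Ioc a n)) :=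
  isProbabilityMeasure_sumLaw hX fun i hi => by rw [Finset.mem_Ioc] at hi; omega

lemma ShiftBound.sumLaw_Ioc_mono (hX : ∀ i, 1 ≤ i → Measurable (X i))
    (hind : iIndepFun (fun i : ℕ+ => X (i : ℕ)) P) {a b n : ℕ} (hab : a ≤ b) {t : ℤ} {c : ℝ}
    (h : ShiftBound (sumLaw P X (Finset.Ioc b n)) t c) :
    ShiftBound (sumLaw P X (Finset.Ioc a n)) t c :=
  h.sumLaw_mono hX hind (Finset.Ioc_subset_Ioc_left hab)
    fun i hi => by rw [Finset.mem_Ioc] at hi; omega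

/-- A shift by `s 2^g` either vanishes or is doubled by an exchange, so its bound decays
geometrically in the number of scales. -/
lemma shiftBound_doubling (hX : ∀ i, 1 ≤ i → Measurable (X i))
    (hind : iIndepFun (fun i : ℕ+ => X (i : ℕ)) P) {k s n : ℕ} {ψ ρ : ℝ}
    (hk : 1 ≤ k) (hs : 1 ≤ s) (hψ : 0 < ψ)
    (hgood : ∀ g j : ℕ, 1 ≤ j →
      (goodIndices P X (s * 2 ^ g) ψ ∩ Set.Icc (j * k + 1) ((j + 1) * k)).Nonempty)
    (hρ0 : 0 ≤ ρ) (hρ : (1 - ρ) * 2 ≤ 1 - Real.exp (-(ψ / (2 * k)))) (L : ℕ) :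
    ∀ v : ℕ, 1 ≤ v → k * v * 4 ^ L ≤ n → ∀ g : ℕ, s * 2 ^ g ≤ k * v →
      ShiftBound (sumLaw P X (Finset.Ioc (k * v) n)) ((s * 2 ^ g : ℕ) : ℤ) (ρ ^ L) := by
  induction L with
  | zero =>
    intro v _ _ g _
    have := isProbabilityMeasure_sumLaw_Ioc (P := P) hX (k * v) n
    simpa using shiftBound_one _ _
  | succ L ih =>
    intro v hv hn g hg
    have e4 : k * (4 * v) = 4 * (k * v) := by ring
    have hn' : k * (4 * v) * 4 ^ L ≤ n := by rw [e4]; rw [pow_succ] at hn; linarith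
    have ih := ih (4 * v) (by omega) hn'
    rw [e4] at ih
    have h4n : 4 * (k * v) ≤ n := by
      rw [e4] at hn'
      exact (Nat.le_mul_of_pos_right _ (by positivity)).trans hn'
    have h₀ := ih g (by omega)
    have h₁ := ih (g + 1) (by rw [pow_succ, ← mul_assoc]; omega)
    have e1 : ((s * 2 ^ (g + 1) : ℕ) : ℤ) = ((s * 2 ^ g : ℕ) : ℤ) + ((s * 2 ^ g : ℕ) : ℤ) := by
      push_cast; ring
    rw [e1] at h₁
    have h₂ := shiftBound_zero (sumLaw P X (Finset.Ioc (4 * (k * v)) n))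
    rw [← sub_self ((s * 2 ^ g : ℕ) : ℤ)] at h₂
    have hpos : (0 : ℝ) ≤ ρ ^ L := by positivity
    refine (ShiftBound.sumLaw_Ioc_step hX hind hk hv
      (Nat.mul_pos hs (by positivity)) hg hψ (hgood g) h4n
      h₀ h₁ h₂ (by linarith)).mono ?_
    -- With `π = exp(-ψ/(2k))`, the new bound is `π ρ^L + (1-π) ρ^L/2 = ρ^L (1+π)/2`, and `hρ` says
    -- `(1+π)/2 ≤ ρ`.
    rw [pow_succ]
    nlinarith [mul_le_mul_of_nonneg_left hρ hpos]

/-- Exchanges of step `r` move a shift `1 + r m` by `±r`; the shifts with `m₀ ≤ m ≤ m₁` are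
controlled by their values at the two endpoints, up to a geometrically small error. -/
lemma shiftBound_walk (hX : ∀ i, 1 ≤ i → Measurable (X i))
    (hind : iIndepFun (fun i : ℕ+ => X (i : ℕ)) P) {k r n : ℕ} {ψ ρ E : ℝ} {m₀ m₁ : ℤ}
    (hk : 1 ≤ k) (hr : 1 ≤ r) (hψ : 0 < ψ)
    (hgood : ∀ j : ℕ, 1 ≤ j →
      (goodIndices P X r ψ ∩ Set.Icc (j * k + 1) ((j + 1) * k)).Nonempty)
    (hρ0 : 0 ≤ ρ) (hρ1 : ρ ≤ 1)
    (hρ : (1 - ρ) * (1 + ((m₁ : ℝ) - m₀) ^ 2) ≤ 1 - Real.exp (-(ψ / (2 * k))))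
    (hE : 0 ≤ E) (L : ℕ) :
    ∀ v : ℕ, 1 ≤ v → r ≤ k * v → k * v * 4 ^ L ≤ n →
      ShiftBound (sumLaw P X (Finset.Ioc (k * v * 4 ^ L) n)) (1 + r * m₀) E →
      ShiftBound (sumLaw P X (Finset.Ioc (k * v * 4 ^ L) n)) (1 + r * m₁) E →
      ∀ m : ℤ, m₀ ≤ m → m ≤ m₁ →
        ShiftBound (sumLaw P X (Finset.Ioc (k * v) n)) (1 + r * m)
          (ρ ^ L * (1 + ((m : ℝ) - m₀) * (m₁ - m)) + E) := by
  have hG : ∀ m : ℤ, m₀ ≤ m → m ≤ m₁ → 0 ≤ ((m : ℝ) - m₀) * (m₁ - m) := fun m h0 h1 =>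
    mul_nonneg (sub_nonneg.2 (by exact_mod_cast h0)) (sub_nonneg.2 (by exact_mod_cast h1))
  induction L with
  | zero =>
    intro v _ _ _ _ _ m h0 h1
    have := isProbabilityMeasure_sumLaw_Ioc (P := P) hX (k * v) n
    exact (shiftBound_one _ _).mono (by linarith [hG m h0 h1])
  | succ L ih =>
    intro v hv hrv hn hE0 hE1 m h0 h1
    have hpos : (0 : ℝ) ≤ ρ ^ L := by positivity
    have hpos' : (0 : ℝ) ≤ ρ ^ (L + 1) := by positivity
    have hle : k * v ≤ k * v * 4 ^ (L + 1) := Nat.le_mul_of_pos_right _ (by positivity)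
    have hend : E ≤ ρ ^ (L + 1) * (1 + ((m : ℝ) - m₀) * (m₁ - m)) + E := by
      have := mul_nonneg hpos' (add_nonneg zero_le_one (hG m h0 h1))
      linarith
    rcases h0.eq_or_lt with rfl | h0'
    · exact (hE0.sumLaw_Ioc_mono hX hind hle).mono hend
    rcases h1.eq_or_lt with rfl | h1'
    · exact (hE1.sumLaw_Ioc_mono hX hind hle).mono hend
    have e4 : k * (4 * v) = 4 * (k * v) := by ring
    have e4' : k * (4 * v) * 4 ^ L = k * v * 4 ^ (L + 1) := by ring
    have ih := ih (4 * v) (by omega) (by omega) (by rwa [e4']) (by rwa [e4']) (by rwa [e4'])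
    rw [e4] at ih
    have h4n : 4 * (k * v) ≤ n := by
      rw [← e4', e4] at hn
      exact (Nat.le_mul_of_pos_right _ (by positivity)).trans hn
    have h₀ := ih m h0 h1
    have h₁ := ih (m + 1) (by omega) (by omega)
    have h₂ := ih (m - 1) (by omega) (by omega)
    rw [show 1 + (r : ℤ) * (m + 1) = 1 + r * m + r by ring] at h₁
    rw [show 1 + (r : ℤ) * (m - 1) = 1 + r * m - r by ring] at h₂
    push_cast at h₁ h₂
    refine (ShiftBound.sumLaw_Ioc_step hX hind hk hv hr hrv hψ hgood h4n
      h₀ h₁ h₂ (by nlinarith)).mono ?_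
    set π := Real.exp (-(ψ / (2 * k)))
    set A : ℝ := (m : ℝ) - m₀ with hA
    set B : ℝ := (m₁ : ℝ) - m with hB
    have hA0 : 0 ≤ A := sub_nonneg.2 (by exact_mod_cast h0)
    have hB0 : 0 ≤ B := sub_nonneg.2 (by exact_mod_cast h1)
    have hAB : 1 + A * B ≤ 1 + ((m₁ : ℝ) - m₀) ^ 2 := by
      rw [show (m₁ : ℝ) - m₀ = A + B by rw [hA, hB]; ring]
      nlinarith [mul_nonneg hA0 hB0]
    -- The average of `(A+1)(B-1)` and `(A-1)(B+1)` is `AB - 1`. A step thus lowers `1 + AB` by `1 -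
    -- π`, which is at least the fraction `1 - ρ` of it.
    have key : (1 - ρ) * (1 + A * B) ≤ 1 - π :=
      (mul_le_mul_of_nonneg_left hAB (by linarith)).trans hρ
    have := mul_le_mul_of_nonneg_left key hpos
    rw [show (m : ℝ) + 1 - m₀ = A + 1 by rw [hA]; ring,
      show (m₁ : ℝ) - (m + 1) = B - 1 by rw [hB]; ring,
      show (m : ℝ) - 1 - m₀ = A - 1 by rw [hA]; ring,
      show (m₁ : ℝ) - (m - 1) = B + 1 by rw [hB]; ring, pow_succ]
    linarith

end Decay

/-! ### Total variation, choice of constants and conclusion. -/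

lemma tvDist_le_of_shiftBound {Ω : Type*} [MeasurableSpace Ω] {P : Measure Ω}
    [IsProbabilityMeasure P] {X : ℕ → Ω → ℕ} (hX : ∀ i, 1 ≤ i → Measurable (X i)) {a n : ℕ}
    {c : ℝ} (h : ShiftBound (sumLaw P X (Finset.Ioc a n)) 1 c) :
    tvDist (P.map (partialSum X a n)) (P.map fun ω => partialSum X a n ω + 1) ≤ c := by
  have hm : Measurable (partialSum X a n) :=
    measurable_finsetSum hX fun i hi => by rw [Finset.mem_Ioc] at hi; omega
  have hm1 : Measurable fun ω => partialSum X a n ω + 1 := hm.add_const 1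
  have := Measure.isProbabilityMeasure_map (μ := P) hm.aemeasurable
  have := Measure.isProbabilityMeasure_map (μ := P) hm1.aemeasurable
  have key : ∀ A : Set ℕ, (P.map (partialSum X a n)).real A
      - (P.map fun ω => partialSum X a n ω + 1).real A ≤ c := by
    intro A
    have hA : MeasurableSet A := MeasurableSet.of_discrete
    refine le_of_eq_of_le ?_ (h (fun x => A.indicator 1 x.toNat) fun x =>
      ⟨Set.indicator_nonneg (fun _ _ => zero_le_one) _,
        Set.indicator_le_self' (fun _ _ => zero_le_one) _⟩)
    have hmZ : Measurable fun ω => ((partialSum X a n ω : ℕ) : ℤ) :=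
      (measurable_of_countable _).comp hm
    change _ = ∫ x, _ ∂(P.map fun ω => ((partialSum X a n ω : ℕ) : ℤ))
    rw [integral_map hmZ.aemeasurable (measurable_of_countable _).aestronglyMeasurable]
    have e : ∀ m : ℕ, ((m : ℤ) + 1).toNat = m + 1 := fun m => by omega
    have hmi : ∀ f : Ω → ℕ, Measurable f →
        ∫ ω, A.indicator (1 : ℕ → ℝ) (f ω) ∂P = (P.map f).real A ∧
        Integrable (fun ω => A.indicator (1 : ℕ → ℝ) (f ω)) P := by
      intro f hf
      have hfA : (fun ω => A.indicator (1 : ℕ → ℝ) (f ω)) = (f ⁻¹' A).indicator 1 := rfl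
      rw [hfA, integral_indicator_one (hf hA), map_measureReal_apply hf hA]
      exact ⟨rfl, (integrable_const (1 : ℝ)).indicator (hf hA)⟩
    simp only [e, Int.toNat_natCast]
    have := integral_sub (hmi _ hm).2 (hmi _ hm1).2
    rw [(hmi _ hm).1, (hmi _ hm1).1] at this
    exact this.symm
  have : Nonempty {A : Set ℕ // MeasurableSet A} := ⟨⟨∅, MeasurableSet.empty⟩⟩
  refine ciSup_le fun ⟨A, hA⟩ => abs_le.2 ⟨?_, key A⟩
  -- Complements turn the one-sided bound into a bound on the absolute value.
  have := key Aᶜ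
  rw [probReal_compl_eq_one_sub hA, probReal_compl_eq_one_sub hA] at this
  simp only
  linarith

/-- With `16^(-γ₀) = ρ`, the upper bound on `1/(M x)` makes `K ρ^L` at most a constant times `x^γ₀`.
Half of the exponent is given up, so that for small `x` the spare factor `x^(γ₀/2)` brings the
constant down to 6. -/
lemma exists_rpow_bound {ρ K M : ℝ} (hρ0 : 0 < ρ) (hρ1 : ρ < 1) (hK : 0 < K) (hM : 0 < M) :
    ∃ C γ : ℝ, 0 < C ∧ 0 < γ ∧ C ≤ 1 / M ∧ ∀ (x : ℝ) (L : ℕ), 0 < x → x ≤ C →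
      1 / (M * x) < 16 ^ (L + 1) → K * ρ ^ L ≤ 6 * x ^ γ := by
  set γ₀ : ℝ := -Real.log ρ / Real.log 16
  have hlog : 0 < Real.log 16 := Real.log_pos (by norm_num)
  have hγ₀ : 0 < γ₀ := div_pos (neg_pos.2 (Real.log_neg hρ0 hρ1)) hlog
  have h16 : ((16 : ℝ)⁻¹) ^ γ₀ = ρ := by
    rw [Real.rpow_def_of_pos (by norm_num), Real.log_inv,
      show -Real.log 16 * γ₀ = Real.log ρ by simp only [γ₀]; field_simp, Real.exp_log hρ0]
  set K₂ : ℝ := K / ρ * M ^ γ₀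
  have hK₂ : 0 < K₂ := by positivity
  refine ⟨min (1 / M) ((6 / K₂) ^ (2 / γ₀)), γ₀ / 2, by positivity, by positivity,
    min_le_left _ _, fun x L hx hxC hL => ?_⟩
  have h1 : ρ ^ (L + 1) ≤ M ^ γ₀ * x ^ γ₀ := by
    rw [← Real.mul_rpow hM.le hx.le, ← h16, ← Real.rpow_natCast, ← Real.rpow_mul (by norm_num),
      mul_comm, Real.rpow_mul (by norm_num), Real.rpow_natCast]
    refine Real.rpow_le_rpow (by positivity) ?_ hγ₀.le
    rw [inv_pow, inv_le_comm₀ (by positivity) (by positivity), ← one_div]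
    exact hL.le
  have h2 : x ^ (γ₀ / 2) ≤ 6 / K₂ := by
    calc x ^ (γ₀ / 2) ≤ ((6 / K₂) ^ (2 / γ₀)) ^ (γ₀ / 2) :=
          Real.rpow_le_rpow hx.le (hxC.trans (min_le_right _ _)) (by positivity)
      _ = 6 / K₂ := by
          rw [← Real.rpow_mul (by positivity), show 2 / γ₀ * (γ₀ / 2) = 1 by field_simp,
            Real.rpow_one]
  have h3 : x ^ γ₀ = x ^ (γ₀ / 2) * x ^ (γ₀ / 2) := by rw [← Real.rpow_add hx]; congr 1; ring
  calc K * ρ ^ L = K / ρ * ρ ^ (L + 1) := by rw [pow_succ]; field_simp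
    _ ≤ K / ρ * (M ^ γ₀ * x ^ γ₀) := by gcongr
    _ = K₂ * x ^ (γ₀ / 2) * x ^ (γ₀ / 2) := by rw [h3]; ring
    _ ≤ K₂ * (6 / K₂) * x ^ (γ₀ / 2) := by gcongr
    _ = 6 * x ^ (γ₀ / 2) := by rw [mul_div_cancel₀ _ hK₂.ne']

/-- A Bézout relation `u r + w s = 1` gives `m = -u`; adding `±s|u|` keeps `1 + r m` divisible by
`s` and places the two solutions on either side of 0. -/
lemma exists_multiples_around_one {r s : ℕ} (hs : 1 ≤ s) (hrs : Nat.Coprime r s) :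
    ∃ m₀ m₁ x₀ x₁ : ℤ, m₀ ≤ 0 ∧ 0 ≤ m₁ ∧ 1 + (r : ℤ) * m₀ = s * x₀ ∧
      1 + (r : ℤ) * m₁ = s * x₁ := by
  obtain ⟨u, w, h⟩ := Nat.isCoprime_iff_coprime.2 hrs
  have hsz : (1 : ℤ) ≤ s := by exact_mod_cast hs
  have h1 := mul_le_mul_of_nonneg_right hsz (abs_nonneg u)
  refine ⟨-u - s * |u|, -u + s * |u|, w - r * |u|, w + r * |u|, ?_, ?_, ?_, ?_⟩
  · linarith [neg_abs_le u]
  · linarith [le_abs_self u]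
  · linear_combination -h
  · linear_combination -h

end DickmanCoupling

open DickmanCoupling in
theorem mainTheorem3 (r s : ℕ) (hr : 1 ≤ r) (hs : 1 ≤ s) (hrs : Nat.Coprime r s)
    (k : ℕ) (hk : 1 ≤ k) (ψ : ℝ) (hψ : 0 < ψ) :
    ∃ C γ : ℝ, 0 < C ∧ 0 < γ ∧
      ∀ (Ω : Type*) [MeasurableSpace Ω] (P : Measure Ω) [IsProbabilityMeasure P]
        (X : ℕ → Ω → ℕ),
        (∀ i : ℕ, 1 ≤ i → Measurable (X i)) →
        iIndepFun (fun i : ℕ+ => X (i : ℕ)) P →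
        DickmanCoupling.BlockCondition P X (DickmanCoupling.stepSizes r s) k ψ →
        ∀ a n : ℕ, a < n → (a : ℝ) + 1 ≤ C * (n : ℝ) →
          DickmanCoupling.tvDist
              (P.map (DickmanCoupling.partialSum X a n))
              (P.map (fun ω => DickmanCoupling.partialSum X a n ω + 1))
            ≤ 6 * (((a : ℝ) + 1) / (n : ℝ)) ^ γ := by
  obtain ⟨m₀, m₁, x₀, x₁, hm₀, hm₁, hx₀, hx₁⟩ := exists_multiples_around_one hs hrs
  set π : ℝ := Real.exp (-(ψ / (2 * k))) with hπ
  have hkR : (0 : ℝ) < k := by exact_mod_cast hk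
  have hπ0 : 0 < π := Real.exp_pos _
  have hπ1 : π < 1 := by rw [hπ, Real.exp_lt_one_iff]; exact neg_neg_of_pos (by positivity)
  set W : ℝ := (m₁ : ℝ) - m₀
  -- The denominator dominates both 2 and `1 + W^2`, so one rate `ρ` serves the doubling and the
  -- walk.
  set ρ : ℝ := 1 - (1 - π) / (2 + W ^ 2) with hρ
  have hfrac : (1 - ρ) * (2 + W ^ 2) = 1 - π := by
    rw [hρ, sub_sub_cancel, div_mul_cancel₀ _ (by positivity)]
  have hρ1 : ρ < 1 := by
    rw [hρ]; exact sub_lt_self _ (div_pos (by linarith) (by positivity))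
  have hρW : (1 - ρ) * 2 ≤ 1 - π := by nlinarith [sq_nonneg W]
  have hρ0 : 0 < ρ := by linarith
  -- The first two terms are the walk's `1 + (m - m₀)(m₁ - m)` at `m = 0`; the others count the
  -- shifts by `s` that make up the endpoint shifts `s x₀` and `s x₁`.
  set K : ℝ := 1 + (-m₀ : ℝ) * m₁ + (x₀.natAbs + x₁.natAbs)
  have hm₀R : (m₀ : ℝ) ≤ 0 := by exact_mod_cast hm₀
  have hm₁R : (0 : ℝ) ≤ m₁ := by exact_mod_cast hm₁
  have hK : 0 < K := by
    have := mul_nonneg (neg_nonneg.2 hm₀R) hm₁R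
    positivity
  have hM : (0 : ℝ) < (k * (r * s) : ℕ) := by positivity
  obtain ⟨C, γ, hC, hγ, hCM, hbound⟩ := exists_rpow_bound hρ0 hρ1 hK hM
  refine ⟨C, γ, hC, hγ, fun Ω _ P _ X hX hind hblock a n han haC => ?_⟩
  have hn : (0 : ℝ) < n := by exact_mod_cast (by omega : 0 < n)
  set x : ℝ := ((a : ℝ) + 1) / n with hx
  have hx0 : 0 < x := by positivity
  have hxC : x ≤ C := (div_le_iff₀ hn).2 haC
  obtain ⟨L, hL, hL'⟩ := exists_nat_pow_near (x := 1 / ((k * (r * s) : ℕ) * x)) (y := (16 : ℝ))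
    (by rw [one_le_div (by positivity), mul_comm]; exact (le_div_iff₀ hM).1 (hxC.trans hCM))
    (by norm_num)
  refine le_trans (tvDist_le_of_shiftBound hX ?_) (hbound x L hx0 hxC hL')
  have hN : k * (r * s * (a + 1)) * 16 ^ L ≤ n := by
    rw [le_div_iff₀ (by positivity), hx, mul_div_assoc', mul_div_assoc', div_le_one hn] at hL
    have : (((k * (r * s * (a + 1)) * 16 ^ L : ℕ)) : ℝ) ≤ n := by
      push_cast at hL ⊢
      linarith
    exact_mod_cast this
  -- This starting scale makes `kv` at least `r`, `s` and `a`, while keeping it a constant multiple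
  -- of `a + 1`.
  set v : ℕ := r * s * (a + 1) with hv
  have hv1 : 1 ≤ v := Nat.mul_pos (Nat.mul_pos hr hs) (Nat.succ_pos a)
  have hvk : v ≤ k * v := Nat.le_mul_of_pos_left _ hk
  have hrv : r ≤ k * v := by
    refine le_trans ?_ hvk
    rw [hv, mul_assoc]; exact Nat.le_mul_of_pos_right _ (by positivity)
  have hsv : s ≤ v := by
    rw [hv, mul_comm r, mul_assoc]; exact Nat.le_mul_of_pos_right _ (by positivity)
  have hav : a ≤ k * v := by
    refine le_trans ?_ hvk
    rw [hv]; exact (Nat.le_succ a).trans (Nat.le_mul_of_pos_left _ (by positivity))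
  have h16 : k * v * 4 ^ L * 4 ^ L ≤ n := by
    rwa [mul_assoc, ← mul_pow]
  have h4 : k * v * 4 ^ L ≤ n := (Nat.le_mul_of_pos_right _ (by positivity)).trans h16
  have hsL : s ≤ k * (v * 4 ^ L) := by
    rw [← mul_assoc]
    exact (hsv.trans hvk).trans (Nat.le_mul_of_pos_right _ (by positivity))
  -- The doubling uses the scales from `kv 4^L` to `kv 16^L ≤ n`, which leaves those from `kv` to
  -- `kv 4^L` to the walk.
  have hdouble := shiftBound_doubling (n := n) hX hind hk hs hψ
    (fun g j hj => hblock (s * 2 ^ g) (Or.inr ⟨g, rfl⟩) j hj) hρ0.le hρW L (v * 4 ^ L)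
    (Nat.mul_pos hv1 (by positivity)) (by rwa [← mul_assoc]) 0 (by simpa using hsL)
  rw [← mul_assoc, pow_zero, mul_one] at hdouble
  have := isProbabilityMeasure_sumLaw_Ioc (P := P) hX (k * v * 4 ^ L) n
  have hpow : 0 ≤ ρ ^ L := by positivity
  have hwalk := shiftBound_walk (n := n) (m₀ := m₀) (m₁ := m₁)
    (E := ρ ^ L * (x₀.natAbs + x₁.natAbs)) hX hind hk hr hψ
    (fun j hj => hblock r (Or.inl rfl) j hj) hρ0.le hρ1.le (by linarith) (by positivity) L v hv1
    hrv h4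
    (by
      rw [hx₀]
      refine (hdouble.int_mul x₀).mono (mul_le_mul_of_nonneg_left ?_ hpow)
      linarith [(Nat.cast_nonneg x₁.natAbs : (0 : ℝ) ≤ _)])
    (by
      rw [hx₁]
      refine (hdouble.int_mul x₁).mono (mul_le_mul_of_nonneg_left ?_ hpow)
      linarith [(Nat.cast_nonneg x₀.natAbs : (0 : ℝ) ≤ _)])
    0 hm₀ hm₁
  rw [mul_zero, add_zero] at hwalk
  refine (hwalk.sumLaw_Ioc_mono hX hind hav).mono (le_of_eq ?_)
  simp only [K]
  push_cast
  ring
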